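/- Let $(\Omega,\mathcal F,\mathbb P)$ be a probability space, $\alpha>0$, $X_{0-}$ a real-valued random variable, and $Z=(Z_t)_{t\ge 0}$ a real-valued stochastic process with continuous paths and $Z_0=0$, independent of $X_{0-}$. Suppose that $Z$ has the crossing property: for every stopping time $\tau$ (with values in $[0,\infty]$) of the natural filtration of $X_{0-}+Z$ and every $h>0$, $$\mathbb P\Big(\tau<\infty,\ \inf_{0\le s\le h}(Z_{\tau+s}-Z_\tau)=0\Big)=0 .$$ Let $M$ be the set of all increasing càdlàg functions $\ell\colon[-\infty,\infty]\to[0,1]$ with $\ell_{0-}=0$ and $\ell_\infty=1$, with the topology (of convergence in distribution on $[0,\infty]$) in which $\ell^n\to\ell$ if and only if $\ell^n_t\to\ell_t$ for every $t\in[0,\infty]$ at which $\ell$ is continuous. For $\ell\in M$ put $$X_t[\ell]=X_{0-}+Z_t-\alpha\ell_t\quad(t\ge 0),\qquad \tau[\ell]=\inf\{t\ge 0: X_t[\ell]\le 0\},\qquad \Gamma[\ell]_t=\mathbb P(\tau[\ell]\le t)\quad(t\in[-\infty,\infty]),$$ with $\inf\emptyset=\infty$. Then $\Gamma$ maps $M$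 into $M$, and $\Gamma\colon M\to M$ is continuous. -/

import Mathlib

open Set Filter Topology MeasureTheory ProbabilityTheory
open scoped NNReal

/-- A function on the extended real line is càdlàg if it is right-continuous and has left limits.
(At `⊤` right-continuity is void, at `⊥` the existence of a left limit is void.) -/
def IsCadlagEReal (f : EReal → ℝ) : Prop :=
  (∀ t, ContinuousWithinAt f (Ioi t) t) ∧ ∀ t, ∃ l : ℝ, Tendsto f (𝓝[<] t) (𝓝 l)

/-- The space `M` of cumulative distribution functions on `[0, ∞]`: càdlàg increasing functions
`ℓ` from the extended real line to `[0, 1]` with `ℓ_{0-} = 0` and `ℓ_∞ = 1`. -/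
structure DistFun where
  toFun : EReal → ℝ
  mem_Icc' : ∀ t, toFun t ∈ Icc (0 : ℝ) 1
  cadlag' : IsCadlagEReal toFun
  mono' : Monotone toFun
  leftLim_zero' : Tendsto toFun (𝓝[<] (0 : EReal)) (𝓝 0)
  top' : toFun ⊤ = 1

namespace DistFun

instance : CoeFun DistFun (fun _ => EReal → ℝ) := ⟨toFun⟩

/-- The points `t ∈ [0, ∞]` at which `ℓ` is continuous. -/
def contPts (ℓ : DistFun) : Set EReal := {t | 0 ≤ t ∧ ContinuousAt ℓ t}

/-- The filter of pointwise convergence to `ℓ` at the continuity points of `ℓ` in `[0, ∞]`. -/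
def nhdsFilter (ℓ : DistFun) : Filter DistFun :=
  ⨅ t ∈ ℓ.contPts, comap (fun m : DistFun => m t) (𝓝 (ℓ t))

/-- The topology of `M` (that of convergence in distribution on `[0, ∞]`): the neighbourhoods of
`ℓ` are those given by pointwise convergence at the continuity points of `ℓ`, see `nhds_eq` and
`tendsto_iff`. -/
instance : TopologicalSpace DistFun := TopologicalSpace.mkOfNhds nhdsFilter

lemma tendsto_nhdsFilter_iff {β : Type*} {F : Filter β} {u : β → DistFun} {ℓ : DistFun} :
    Tendsto u F ℓ.nhdsFilter ↔ ∀ t ∈ ℓ.contPts, Tendsto (fun b => u b t) F (𝓝 (ℓ t)) := by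
  simp only [nhdsFilter, tendsto_iInf, tendsto_comap_iff]
  rfl

lemma exists_contPt (m : DistFun) {a b : EReal} (hab : a < b) :
    ∃ c, a < c ∧ c < b ∧ ContinuousAt m c := by
  obtain ⟨p, hap, hpb⟩ := EReal.lt_iff_exists_real_btwn.1 hab
  obtain ⟨q, hpq, hqb⟩ := EReal.lt_iff_exists_real_btwn.1 hpb
  have hc : {t : ℝ | ¬ ContinuousAt m (t : EReal)}.Countable :=
    m.mono'.countable_not_continuousAt.preimage EReal.coe_injective
  obtain ⟨c, hc1, hc2, hc3⟩ := (hc.dense_compl ℝ).exists_between (EReal.coe_lt_coe_iff.1 hpq)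
  exact ⟨c, hap.trans (EReal.coe_lt_coe_iff.2 hc2), (EReal.coe_lt_coe_iff.2 hc3).trans hqb,
    not_not.1 hc1⟩

lemma eventually_nhdsFilter {m : DistFun} {t : EReal} (ht : t ∈ m.contPts) {U : Set ℝ}
    (hU : U ∈ 𝓝 (m t)) : ∀ᶠ k in m.nhdsFilter, k t ∈ U :=
  tendsto_nhdsFilter_iff.1 (tendsto_id (x := m.nhdsFilter)) t ht hU

theorem nhds_eq (ℓ : DistFun) : 𝓝 ℓ = ℓ.nhdsFilter := by
  refine TopologicalSpace.nhds_mkOfNhds_of_hasBasis (n := nhdsFilter)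
    (fun a => a.nhdsFilter.basis_sets) ?_ ?_ ℓ
  · intro a s hs
    have h : Tendsto (fun _ : Unit => a) ⊤ a.nhdsFilter :=
      tendsto_nhdsFilter_iff.2 fun t _ => tendsto_const_nhds
    have h2 : ∀ _ : Unit, a ∈ s := by simpa using h hs
    exact h2 ()
  · intro a s hs
    suffices h : (a.nhdsFilter).bind nhdsFilter ≤ a.nhdsFilter from h hs
    refine tendsto_id'.1 (tendsto_nhdsFilter_iff.2 fun t ht => tendsto_order.2 ⟨?_, ?_⟩)
    · intro r hr
      change ∀ᶠ m in a.nhdsFilter, ∀ᶠ k in m.nhdsFilter, r < k t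
      rcases ht.1.eq_or_lt with h0 | h0
      · have ha : a t = 0 := by
          subst h0
          have : (𝓝[<] (0 : EReal)).NeBot := nhdsLT_neBot_of_exists_lt ⟨⊥, by simp⟩
          exact tendsto_nhds_unique (ht.2.tendsto.mono_left nhdsWithin_le_nhds) a.leftLim_zero'
        exact Eventually.of_forall fun m => Eventually.of_forall fun k =>
          (ha ▸ hr).trans_le (k.mem_Icc' t).1
      · obtain ⟨b, hbt, hb⟩ := exists_Ioc_subset_of_mem_nhds (ht.2 (Ioi_mem_nhds hr)) ⟨0, h0⟩
        obtain ⟨c, hc1, hc2, hc3⟩ := a.exists_contPt (max_lt hbt h0)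
        have hcr : r < a c := hb ⟨(le_max_left _ _).trans_lt hc1, hc2.le⟩
        have hc0 : 0 < c := (le_max_right _ _).trans_lt hc1
        filter_upwards [eventually_nhdsFilter (m := a) ⟨hc0.le, hc3⟩ (Ioi_mem_nhds hcr)] with m hm
        obtain ⟨d, hd1, hd2, hd3⟩ := m.exists_contPt hc2
        have hdr : r < m d := lt_of_lt_of_le hm (m.mono' hd1.le)
        filter_upwards [eventually_nhdsFilter (m := m) ⟨(hc0.trans hd1).le, hd3⟩
          (Ioi_mem_nhds hdr)] with k hk
        exact lt_of_lt_of_le hk (k.mono' hd2.le)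
    · intro r hr
      change ∀ᶠ m in a.nhdsFilter, ∀ᶠ k in m.nhdsFilter, k t < r
      rcases eq_or_ne t ⊤ with h0 | h0
      · subst h0
        rw [a.top'] at hr
        exact Eventually.of_forall fun m => Eventually.of_forall fun k => k.top'.trans_lt hr
      · have h0 : t < ⊤ := lt_top_iff_ne_top.2 h0
        obtain ⟨b, hbt, hb⟩ := exists_Ico_subset_of_mem_nhds (ht.2 (Iio_mem_nhds hr)) ⟨⊤, h0⟩
        obtain ⟨c, hc1, hc2, hc3⟩ := a.exists_contPt hbt
        have hcr : a c < r := hb ⟨hc1.le, hc2⟩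
        have hc0 : 0 ≤ c := ht.1.trans hc1.le
        filter_upwards [eventually_nhdsFilter (m := a) ⟨hc0, hc3⟩ (Iio_mem_nhds hcr)] with m hm
        obtain ⟨d, hd1, hd2, hd3⟩ := m.exists_contPt hc1
        have hdr : m d < r := lt_of_le_of_lt (m.mono' hd2.le) hm
        filter_upwards [eventually_nhdsFilter (m := m) ⟨ht.1.trans hd1.le, hd3⟩
          (Iio_mem_nhds hdr)] with k hk
        exact lt_of_le_of_lt (k.mono' hd1.le) hk

/-- Convergence in `M` is pointwise convergence at the continuity points in `[0, ∞]` of the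
limit. -/
theorem tendsto_iff {β : Type*} {F : Filter β} {u : β → DistFun} {ℓ : DistFun} :
    Tendsto u F (𝓝 ℓ) ↔
      ∀ t : EReal, 0 ≤ t → ContinuousAt ℓ t → Tendsto (fun b => u b t) F (𝓝 (ℓ t)) := by
  rw [nhds_eq, tendsto_nhdsFilter_iff]
  exact ⟨fun h t h1 h2 => h t ⟨h1, h2⟩, fun h t ht => h t ht.1 ht.2⟩

end DistFun

/-- The crossing property of `Z` with respect to `X₀`: for every (possibly infinite) stopping time
`τ` of the natural filtration of `Y = X₀ + Z` and every `h > 0`,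
`P(τ < ∞, inf_{0 ≤ s ≤ h} (Z_{τ+s} - Z_τ) = 0) = 0`. -/
def CrossingProperty {Ω : Type*} [MeasurableSpace Ω] (P : Measure Ω) (X₀ : Ω → ℝ)
    (Z : ℝ≥0 → Ω → ℝ) (hY : ∀ t, StronglyMeasurable fun ω => X₀ ω + Z t ω) : Prop :=
  ∀ τ : Ω → WithTop ℝ≥0,
    IsStoppingTime (Filtration.natural (fun t ω => X₀ ω + Z t ω) hY) τ →
    ∀ h : ℝ≥0, 0 < h →
      P {ω | ∃ T : ℝ≥0, τ ω = T ∧ (⨅ s : Icc (0 : ℝ≥0) h, (Z (T + s) ω - Z T ω)) = 0} = 0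

/-- The process `X_t[ℓ] = X₀ + Z_t - α ℓ_t`, `t ≥ 0`. -/
def drivenProcess {Ω : Type*} (X₀ : Ω → ℝ) (Z : ℝ≥0 → Ω → ℝ) (α : ℝ) (ℓ : DistFun)
    (t : ℝ≥0) (ω : Ω) : ℝ :=
  X₀ ω + Z t ω - α * ℓ ((t : ℝ) : EReal)

/-- The hitting time `τ[ℓ] = inf {t ≥ 0 : X_t[ℓ] ≤ 0} ∈ [0, ∞]`, with `inf ∅ = ∞`. -/
noncomputable def hitTime {Ω : Type*} (X₀ : Ω → ℝ) (Z : ℝ≥0 → Ω → ℝ) (α : ℝ) (ℓ : DistFun)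
    (ω : Ω) : EReal :=
  sInf ((fun t : ℝ≥0 => ((t : ℝ) : EReal)) '' {t | drivenProcess X₀ Z α ℓ t ω ≤ 0})

/-! `Γ ℓ` is the distribution function of the hitting time of `ℓ`, so it lies in `M`. For
continuity, let `t < ⊤` be a continuity point of `Γ ℓ`: almost surely the hitting time of `ℓ`
differs from `t`, and it suffices that `m ↦ hitTime X₀ Z α m ω` is almost surely continuous at `ℓ`.
Lower semicontinuity (`eventually_lt_hitTime`) is pathwise: jumps of `ℓ` only push `X` down, so `X`
is jointly lower semicontinuous in `(ℓ, t)`, and positivity on a compact interval survives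
perturbation. Upper semicontinuity (`eventually_hitTime_lt`) uses the crossing property: just after
the hitting time `Z` dips strictly, so `X` becomes negative at a continuity point of `ℓ`, where
nearby `m` converge. Dominated convergence along `𝓝 ℓ` concludes, since that filter is countably
generated. -/

/-! ### Local structure of the topology of `M`. -/

/-- Two extended reals `a < b` with `0 ≤ a` are separated by a nonnegative real continuity point. -/
lemma DistFun.exists_nnreal_contPt (ℓ : DistFun) {a b : EReal} (ha : 0 ≤ a) (hab : a < b) :
    ∃ c : ℝ≥0, a < ((c : ℝ) : EReal) ∧ ((c : ℝ) : EReal) < b ∧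
      ContinuousAt ℓ ((c : ℝ) : EReal) := by
  obtain ⟨c, hac, hcb, hc⟩ := ℓ.exists_contPt hab
  lift c to ℝ using ⟨(hcb.trans_le le_top).ne, (bot_le.trans_lt hac).ne'⟩
  have hc0 : 0 ≤ c := EReal.coe_nonneg.1 (ha.trans hac.le)
  lift c to ℝ≥0 using hc0
  exact ⟨c, hac, hcb, hc⟩

/-- Evaluation `(ℓ, t) ↦ ℓ t` is jointly upper semicontinuous on `M × [0, ∞)`. -/
lemma DistFun.eventually_eval_lt {ℓ : DistFun} {t : ℝ≥0} {r : ℝ}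
    (h : ℓ ((t : ℝ) : EReal) < r) :
    ∀ᶠ p : DistFun × ℝ≥0 in 𝓝 (ℓ, t), p.1 ((p.2 : ℝ) : EReal) < r := by
  obtain ⟨b, hb, hbs⟩ := (mem_nhdsGT_iff_exists_Ioo_subset' (EReal.coe_lt_top (t : ℝ))).1
    (ℓ.cadlag'.1 ((t : ℝ) : EReal) (Iio_mem_nhds h))
  obtain ⟨c, hc1, hc2, hc3⟩ :=
    ℓ.exists_nnreal_contPt (EReal.coe_nonneg.2 t.coe_nonneg) (mem_Ioi.1 hb)
  have hcr : ℓ ((c : ℝ) : EReal) < r := hbs ⟨hc1, hc2⟩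
  have hm : ∀ᶠ m in 𝓝 ℓ, m ((c : ℝ) : EReal) < r :=
    DistFun.tendsto_iff.1 tendsto_id _ (EReal.coe_nonneg.2 c.coe_nonneg) hc3 (Iio_mem_nhds hcr)
  have hu : ∀ᶠ u in 𝓝 t, u < c :=
    Iio_mem_nhds (NNReal.coe_lt_coe.1 (EReal.coe_lt_coe_iff.1 hc1))
  rw [nhds_prod_eq]
  filter_upwards [hm.prod_mk hu] with p hp
  exact (p.1.mono' (EReal.coe_le_coe_iff.2 (NNReal.coe_le_coe.2 hp.2.le))).trans_lt hp.1

/-- By monotonicity, convergence on a countable dense set of continuity points forces convergence at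
every continuity point. This permits dominated convergence along `𝓝 ℓ`. -/
instance DistFun.isCountablyGenerated_nhds (ℓ : DistFun) : (𝓝 ℓ).IsCountablyGenerated := by
  have hc : {t : ℝ | ¬ ContinuousAt ℓ (t : EReal)}.Countable :=
    ℓ.mono'.countable_not_continuousAt.preimage EReal.coe_injective
  obtain ⟨D, hDs, hDc, hD⟩ := (hc.dense_compl ℝ).exists_countable_dense_subset
  have hbtw : ∀ {a b : EReal}, 0 ≤ a → a < b →
      ∃ x : {x : ℝ // x ∈ D ∩ Ici 0}, a < ((x : ℝ) : EReal) ∧ ((x : ℝ) : EReal) < b := by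
    intro a b ha hab
    obtain ⟨p, hap, hpb⟩ := EReal.lt_iff_exists_real_btwn.1 hab
    obtain ⟨q, hpq, hqb⟩ := EReal.lt_iff_exists_real_btwn.1 hpb
    obtain ⟨c, hcD, hpc, hcq⟩ := hD.exists_between (EReal.coe_lt_coe_iff.1 hpq)
    have hac := hap.trans (EReal.coe_lt_coe_iff.2 hpc)
    exact ⟨⟨c, hcD, EReal.coe_nonneg.1 (ha.trans hac.le)⟩, hac,
      (EReal.coe_lt_coe_iff.2 hcq).trans hqb⟩
  have : Countable {x : ℝ // x ∈ D ∩ Ici 0} := (hDc.mono inter_subset_left).to_subtype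
  set F : Filter DistFun := ⨅ x : {x : ℝ // x ∈ D ∩ Ici 0},
    comap (fun m : DistFun => m ((x : ℝ) : EReal)) (𝓝 (ℓ ((x : ℝ) : EReal))) with hF
  have heval (x : {x : ℝ // x ∈ D ∩ Ici 0}) : Tendsto (fun m : DistFun => m ((x : ℝ) : EReal)) F
      (𝓝 (ℓ ((x : ℝ) : EReal))) := tendsto_iff_comap.2 (iInf_le _ x)
  suffices h : 𝓝 ℓ = F by
    rw [h, hF]
    infer_instance
  refine le_antisymm (le_iInf fun x => tendsto_iff_comap.1 ?_) ?_
  · exact DistFun.tendsto_iff.1 tendsto_id _ (EReal.coe_nonneg.2 x.2.2) (not_not.1 (hDs x.2.1))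
  · refine tendsto_id'.1 (DistFun.tendsto_iff.2 fun t ht0 htc => tendsto_order.2 ⟨?_, ?_⟩)
    · intro r hr
      rcases ht0.eq_or_lt with rfl | ht0
      · have : (𝓝[<] (0 : EReal)).NeBot := nhdsLT_neBot_of_exists_lt ⟨⊥, by simp⟩
        have h0 : ℓ 0 = 0 :=
          tendsto_nhds_unique (htc.tendsto.mono_left nhdsWithin_le_nhds) ℓ.leftLim_zero'
        exact Eventually.of_forall fun m => (h0 ▸ hr).trans_le (m.mem_Icc' 0).1
      · obtain ⟨b, hbt, hb⟩ := exists_Ioc_subset_of_mem_nhds (htc (Ioi_mem_nhds hr)) ⟨0, ht0⟩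
        obtain ⟨x, hx1, hx2⟩ := hbtw (le_max_right b 0) (max_lt hbt ht0)
        have hxr : r < ℓ ((x : ℝ) : EReal) := hb ⟨(le_max_left _ _).trans_lt hx1, hx2.le⟩
        filter_upwards [heval x (Ioi_mem_nhds hxr)] with m hm
        exact lt_of_lt_of_le hm (m.mono' hx2.le)
    · intro r hr
      rcases eq_or_ne t ⊤ with rfl | htop
      · exact Eventually.of_forall fun m => m.top'.trans_lt (ℓ.top' ▸ hr)
      · obtain ⟨b, hbt, hb⟩ := exists_Ico_subset_of_mem_nhds (htc (Iio_mem_nhds hr))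
          ⟨⊤, lt_top_iff_ne_top.2 htop⟩
        obtain ⟨x, hx1, hx2⟩ := hbtw ht0 hbt
        have hxr : ℓ ((x : ℝ) : EReal) < r := hb ⟨hx1.le, hx2⟩
        filter_upwards [heval x (Iio_mem_nhds hxr)] with m hm
        exact lt_of_le_of_lt (m.mono' hx1.le) hm

/-! ### Pathwise analysis of the hitting time. -/

section HittingTime

variable {Ω : Type*} {X₀ : Ω → ℝ} {Z : ℝ≥0 → Ω → ℝ} {α : ℝ} {ω : Ω}

lemma eventually_lt_drivenProcess (hZ : Continuous fun t => Z t ω) (hα : 0 < α) {ℓ : DistFun}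
    {t : ℝ≥0} {r : ℝ} (h : r < drivenProcess X₀ Z α ℓ t ω) :
    ∀ᶠ p : DistFun × ℝ≥0 in 𝓝 (ℓ, t), r < drivenProcess X₀ Z α p.1 p.2 ω := by
  unfold drivenProcess at h ⊢
  obtain ⟨c, hc1, hc2⟩ := exists_between (show ℓ ((t : ℝ) : EReal) < (X₀ ω + Z t ω - r) / α by
    rw [lt_div_iff₀ hα]; linarith)
  rw [lt_div_iff₀ hα] at hc2
  have hZt : ∀ᶠ p : DistFun × ℝ≥0 in 𝓝 (ℓ, t), c * α + r - X₀ ω < Z p.2 ω :=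
    (hZ.comp continuous_snd).continuousAt (x := (ℓ, t)) (Ioi_mem_nhds (by
      change _ < Z t ω
      linarith))
  filter_upwards [hZt, DistFun.eventually_eval_lt hc1] with p h1 h2
  nlinarith

lemma eventually_lt_drivenProcess_nhds (hZ : Continuous fun t => Z t ω) (hα : 0 < α)
    {ℓ : DistFun} {t : ℝ≥0} {r : ℝ} (h : r < drivenProcess X₀ Z α ℓ t ω) :
    ∀ᶠ u in 𝓝 t, r < drivenProcess X₀ Z α ℓ u ω :=
  (Continuous.prodMk_right ℓ).continuousAt.eventually (eventually_lt_drivenProcess hZ hα h)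

lemma tendsto_drivenProcess_nhdsGT (hZ : Continuous fun t => Z t ω) (ℓ : DistFun) (t : ℝ≥0) :
    Tendsto (fun u => drivenProcess X₀ Z α ℓ u ω) (𝓝[>] t)
      (𝓝 (drivenProcess X₀ Z α ℓ t ω)) := by
  have hcoe : Tendsto (fun u : ℝ≥0 => ((u : ℝ) : EReal)) (𝓝[>] t) (𝓝[>] ((t : ℝ) : EReal)) := by
    refine tendsto_nhdsWithin_iff.2 ⟨?_, ?_⟩
    · exact ((continuous_coe_real_ereal.comp NNReal.continuous_coe).tendsto t).mono_left
        nhdsWithin_le_nhds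
    · filter_upwards [self_mem_nhdsWithin] with u hu
      exact EReal.coe_lt_coe_iff.2 (NNReal.coe_lt_coe.2 hu)
  exact ((hZ.tendsto t).mono_left nhdsWithin_le_nhds |>.const_add _).sub
    (((ℓ.cadlag'.1 _).tendsto.comp hcoe).const_mul α)

lemma hitTime_nonneg (ℓ : DistFun) : 0 ≤ hitTime X₀ Z α ℓ ω := by
  refine le_sInf ?_
  rintro _ ⟨t, -, rfl⟩
  exact EReal.coe_nonneg.2 t.coe_nonneg

lemma hitTime_le {ℓ : DistFun} {t : ℝ≥0} (h : drivenProcess X₀ Z α ℓ t ω ≤ 0) :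
    hitTime X₀ Z α ℓ ω ≤ ((t : ℝ) : EReal) :=
  sInf_le ⟨t, h, rfl⟩

lemma hitTime_le_coe_iff (hZ : Continuous fun t => Z t ω) (hα : 0 < α) {ℓ : DistFun} {t : ℝ≥0} :
    hitTime X₀ Z α ℓ ω ≤ ((t : ℝ) : EReal) ↔ ∃ s ≤ t, drivenProcess X₀ Z α ℓ s ω ≤ 0 := by
  constructor
  · intro h
    by_contra! hpos
    -- Lower semicontinuity at `t` extends positivity to some `[t, b)`, so the infimum is at least
    -- `b > t`.
    obtain ⟨b, hb, hbs⟩ := exists_Ico_subset_of_mem_nhds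
      (eventually_lt_drivenProcess_nhds hZ hα (hpos t le_rfl)) ⟨t + 1, by simp⟩
    have hle : ((b : ℝ) : EReal) ≤ hitTime X₀ Z α ℓ ω := by
      refine le_sInf ?_
      rintro _ ⟨u, hu, rfl⟩
      refine EReal.coe_le_coe_iff.2 (NNReal.coe_le_coe.2 ?_)
      by_contra! hub
      rcases le_total u t with hut | hut
      · exact (hpos u hut).not_ge hu
      · exact (show 0 < drivenProcess X₀ Z α ℓ u ω from hbs ⟨hut, hub⟩).not_ge hu
    exact (EReal.coe_lt_coe_iff.2 (NNReal.coe_lt_coe.2 hb)).not_ge (hle.trans h)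
  · rintro ⟨s, hst, hs⟩
    exact (hitTime_le hs).trans (EReal.coe_le_coe_iff.2 (NNReal.coe_le_coe.2 hst))

/-- The infimum in the definition of the hitting time is attained when it is finite. -/
lemma exists_hitTime_eq (hZ : Continuous fun t => Z t ω) (hα : 0 < α) {ℓ : DistFun}
    (h : hitTime X₀ Z α ℓ ω < ⊤) :
    ∃ T : ℝ≥0, hitTime X₀ Z α ℓ ω = ((T : ℝ) : EReal) ∧ drivenProcess X₀ Z α ℓ T ω ≤ 0 := by
  have h0 : 0 ≤ hitTime X₀ Z α ℓ ω := hitTime_nonneg ℓ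
  obtain ⟨T, hT⟩ : ∃ T : ℝ≥0, hitTime X₀ Z α ℓ ω = ((T : ℝ) : EReal) := by
    generalize hitTime X₀ Z α ℓ ω = τ at h h0
    lift τ to ℝ using ⟨h.ne, fun hb => by simp [hb] at h0⟩
    lift τ to ℝ≥0 using EReal.coe_nonneg.1 h0
    exact ⟨τ, rfl⟩
  obtain ⟨s, hsT, hs⟩ := (hitTime_le_coe_iff hZ hα).1 hT.le
  have hTs := hitTime_le hs
  rw [hT] at hTs
  have : s = T := hsT.antisymm (NNReal.coe_le_coe.1 (EReal.coe_le_coe_iff.1 hTs))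
  exact ⟨T, hT, this ▸ hs⟩

/-- Only the values up to time `t` enter, so this yields a stopping time of the natural filtration
itself, without right-continuous enlargement. -/
lemma measurableSet_hitTime_le_coe {m : MeasurableSpace Ω} (hZ : ∀ ω, Continuous fun t => Z t ω)
    (hα : 0 < α) (ℓ : DistFun) {t : ℝ≥0}
    (hm : ∀ s ≤ t, Measurable[m] fun ω => X₀ ω + Z s ω) :
    MeasurableSet[m] {ω | hitTime X₀ Z α ℓ ω ≤ ((t : ℝ) : EReal)} := by
  obtain ⟨D, hDc, hD⟩ := TopologicalSpace.exists_countable_dense ℝ≥0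
  have hset : {ω | hitTime X₀ Z α ℓ ω ≤ ((t : ℝ) : EReal)} =
      ⋂ k : ℕ, ⋃ q ∈ insert t (D ∩ Iic t),
        {ω | drivenProcess X₀ Z α ℓ q ω < 1 / ((k : ℝ) + 1)} := by
    ext ω
    simp only [mem_ofPred_eq, mem_iInter, mem_iUnion, exists_prop]
    rw [hitTime_le_coe_iff (hZ ω) hα]
    constructor
    · rintro ⟨s, hst, hs⟩ k
      have hk : drivenProcess X₀ Z α ℓ s ω < 1 / ((k : ℝ) + 1) := hs.trans_lt (by positivity)
      rcases hst.eq_or_lt with rfl | hst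
      · exact ⟨s, mem_insert _ _, hk⟩
      -- Right-continuity moves `s` to a later point of `D`; `s = t` leaves no room below `t`, hence
      -- the inserted `t`.
      · obtain ⟨b, hb, hbs⟩ := (mem_nhdsGT_iff_exists_Ioo_subset' hst).1
          (tendsto_drivenProcess_nhdsGT (hZ ω) ℓ s (Iio_mem_nhds hk))
        obtain ⟨q, hqD, hq1, hq2⟩ := hD.exists_between (lt_min hb hst)
        exact ⟨q, mem_insert_of_mem _ ⟨hqD, (hq2.trans_le (min_le_right _ _)).le⟩,
          hbs ⟨hq1, hq2.trans_le (min_le_left _ _)⟩⟩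
    · intro h
      by_contra! hpos
      -- A lower semicontinuous path attains its minimum on `[0, t]`, so positivity there is
      -- uniform.
      obtain ⟨s, hs, hmin⟩ := LowerSemicontinuousOn.exists_isMinOn
        (f := fun u => drivenProcess X₀ Z α ℓ u ω) (s := Icc 0 t) ⟨t, by simp⟩ isCompact_Icc
        (fun u _ r hr =>
          nhdsWithin_le_nhds (eventually_lt_drivenProcess_nhds (hZ ω) hα hr))
      obtain ⟨k, hk⟩ := exists_nat_one_div_lt (hpos s hs.2)
      obtain ⟨q, hq, hqk⟩ := h k
      have hqt : q ∈ Icc 0 t := by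
        rcases hq with rfl | hq
        · simp
        · exact ⟨zero_le, hq.2⟩
      exact lt_irrefl _ ((hk.trans_le (hmin hqt)).trans hqk)
  rw [hset]
  refine MeasurableSet.iInter fun k =>
    MeasurableSet.biUnion ((hDc.mono inter_subset_left).insert t) fun q hq => ?_
  have hqt : q ≤ t := by
    rcases hq with rfl | hq
    · exact le_rfl
    · exact hq.2
  exact measurableSet_lt ((hm q hqt).sub_const _) measurable_const

lemma measurableSet_hitTime_le [MeasurableSpace Ω] (hX₀ : Measurable X₀)
    (hZm : ∀ t, Measurable (Z t)) (hZ : ∀ ω, Continuous fun t => Z t ω) (hα : 0 < α)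
    (ℓ : DistFun) (t : EReal) : MeasurableSet {ω | hitTime X₀ Z α ℓ ω ≤ t} := by
  rcases lt_or_ge t 0 with h0 | h0
  · convert MeasurableSet.empty
    exact eq_empty_of_forall_notMem fun ω hω => (h0.trans_le (hitTime_nonneg ℓ)).not_ge hω
  · induction t with
    | bot => simp at h0
    | top => simp
    | coe t =>
      lift t to ℝ≥0 using EReal.coe_nonneg.1 h0
      exact measurableSet_hitTime_le_coe hZ hα ℓ fun s _ => hX₀.add (hZm s)

lemma eventually_lt_hitTime (hZ : Continuous fun t => Z t ω) (hα : 0 < α) {ℓ : DistFun} {t : EReal}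
    (ht : t ≠ ⊤) (h : t < hitTime X₀ Z α ℓ ω) : ∀ᶠ m in 𝓝 ℓ, t < hitTime X₀ Z α m ω := by
  rcases lt_or_ge t 0 with h0 | h0
  · exact Eventually.of_forall fun m => h0.trans_le (hitTime_nonneg m)
  lift t to ℝ using ⟨ht, fun hb => by simp [hb] at h0⟩
  lift t to ℝ≥0 using EReal.coe_nonneg.1 h0
  have hpos : ∀ s ∈ Icc 0 t, 0 < drivenProcess X₀ Z α ℓ s ω := fun s hs => by
    by_contra! hs0
    exact h.not_ge ((hitTime_le_coe_iff hZ hα).2 ⟨s, hs.2, hs0⟩)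
  have := isCompact_Icc.eventually_forall_of_forall_eventually
    (P := fun (m : DistFun) s => 0 < drivenProcess X₀ Z α m s ω)
    fun s hs => eventually_lt_drivenProcess hZ hα (hpos s hs)
  filter_upwards [this] with m hm
  by_contra! hle
  obtain ⟨s, hst, hs⟩ := (hitTime_le_coe_iff hZ hα).1 hle
  exact (hm s ⟨zero_le, hst⟩).not_ge hs

/-- If the driving path crosses strictly below its value at the hitting time immediately
afterwards, then the hitting time is upper semicontinuous at `ℓ`. -/
lemma eventually_hitTime_lt (hZ : Continuous fun t => Z t ω) (hα : 0 < α) {ℓ : DistFun} {t : EReal}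
    (hcross : ∀ T : ℝ≥0, hitTime X₀ Z α ℓ ω = ((T : ℝ) : EReal) →
      ∀ h : ℝ≥0, 0 < h → ∃ s ≤ h, Z (T + s) ω < Z T ω)
    (h : hitTime X₀ Z α ℓ ω < t) : ∀ᶠ m in 𝓝 ℓ, hitTime X₀ Z α m ω < t := by
  obtain ⟨T, hT, hXT⟩ := exists_hitTime_eq hZ hα (h.trans_le le_top)
  rw [hT] at h
  obtain ⟨q, hTq, hqt, -⟩ := ℓ.exists_nnreal_contPt (EReal.coe_nonneg.2 T.coe_nonneg) h
  rw [EReal.coe_lt_coe_iff, NNReal.coe_lt_coe] at hTq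
  obtain ⟨p, hTp, hpq⟩ := exists_between hTq
  obtain ⟨s, hs, hZs⟩ := hcross T hT (p - T) (tsub_pos_of_lt hTp)
  have hsq : T + s < q :=
    ((add_le_add_right hs T).trans_eq (add_tsub_cancel_of_le hTp.le)).trans_lt hpq
  have hXs : drivenProcess X₀ Z α ℓ (T + s) ω < 0 := by
    have hmono : ℓ ((T : ℝ) : EReal) ≤ ℓ (((T + s : ℝ≥0) : ℝ) : EReal) :=
      ℓ.mono' (EReal.coe_le_coe_iff.2 (NNReal.coe_le_coe.2 le_self_add))
    have := mul_le_mul_of_nonneg_left hmono hα.le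
    unfold drivenProcess at hXT ⊢
    linarith
  obtain ⟨b, hb, hbs⟩ := (mem_nhdsGT_iff_exists_Ioo_subset' hsq).1
    (tendsto_drivenProcess_nhdsGT hZ ℓ (T + s) (Iio_mem_nhds hXs))
  -- The time `T + s` may be a jump of `ℓ`; right-continuity allows a move to a continuity point
  -- `u`.
  obtain ⟨u, hu1, hu2, hu3⟩ := ℓ.exists_nnreal_contPt
    (EReal.coe_nonneg.2 (T + s).coe_nonneg)
    (EReal.coe_lt_coe_iff.2 (NNReal.coe_lt_coe.2 (lt_min hb hsq)))
  simp only [EReal.coe_lt_coe_iff, NNReal.coe_lt_coe] at hu1 hu2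
  have hXu : drivenProcess X₀ Z α ℓ u ω < 0 := hbs ⟨hu1, hu2.trans_le (min_le_left _ _)⟩
  have hlim : Tendsto (fun m => drivenProcess X₀ Z α m u ω) (𝓝 ℓ)
      (𝓝 (drivenProcess X₀ Z α ℓ u ω)) :=
    ((DistFun.tendsto_iff.1 tendsto_id _
      (EReal.coe_nonneg.2 u.coe_nonneg) hu3).const_mul α).const_sub _
  filter_upwards [hlim (Iio_mem_nhds hXu)] with m hm
  exact (hitTime_le (le_of_lt hm)).trans_lt (lt_trans (EReal.coe_lt_coe_iff.2
    (NNReal.coe_lt_coe.2 (hu2.trans_le (min_le_right _ _)))) hqt)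

end HittingTime

/-! ### Distribution functions of random times. -/

section DistributionFunction

variable {Ω : Type*} [MeasurableSpace Ω] {P : Measure Ω} [IsProbabilityMeasure P] {τ : Ω → EReal}

lemma tendsto_measureReal_of_ae_eventually {ι : Type*} {L : Filter ι} [L.IsCountablyGenerated]
    {A : Set Ω} {As : ι → Set Ω} (hA : MeasurableSet A) (hAs : ∀ i, MeasurableSet (As i))
    (h : ∀ᵐ ω ∂P, ∀ᶠ i in L, ω ∈ As i ↔ ω ∈ A) :
    Tendsto (fun i => P.real (As i)) L (𝓝 (P.real A)) :=
  (ENNReal.tendsto_toReal (measure_ne_top P A)).comp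
    (tendsto_measure_of_ae_tendsto_indicator_of_isFiniteMeasure L hA hAs h)

lemma tendsto_measureReal_le_nhdsGT (hτ : ∀ t, MeasurableSet {ω | τ ω ≤ t}) (t : EReal) :
    Tendsto (fun s => P.real {ω | τ ω ≤ s}) (𝓝[>] t) (𝓝 (P.real {ω | τ ω ≤ t})) := by
  refine tendsto_measureReal_of_ae_eventually (hτ t) hτ (ae_of_all _ fun ω => ?_)
  rcases le_or_gt (τ ω) t with h | h
  · filter_upwards [self_mem_nhdsWithin] with s hs
    exact iff_of_true (h.trans (le_of_lt hs)) h
  · filter_upwards [nhdsWithin_le_nhds (Iio_mem_nhds h)] with s hs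
    exact iff_of_false (not_le.2 hs) (not_le.2 h)

lemma tendsto_measureReal_le_nhdsLT (hτ : ∀ t, MeasurableSet {ω | τ ω ≤ t}) (t : EReal) :
    Tendsto (fun s => P.real {ω | τ ω ≤ s}) (𝓝[<] t) (𝓝 (P.real {ω | τ ω < t})) := by
  refine tendsto_measureReal_of_ae_eventually
    (measurableSet_lt (measurable_of_Iic hτ) measurable_const) hτ (ae_of_all _ fun ω => ?_)
  rcases lt_or_ge (τ ω) t with h | h
  · filter_upwards [nhdsWithin_le_nhds (Ioi_mem_nhds h)] with s hs
    exact iff_of_true (le_of_lt hs) h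
  · filter_upwards [self_mem_nhdsWithin] with s hs
    exact iff_of_false (not_le.2 (lt_of_lt_of_le hs h)) (not_lt.2 h)

lemma monotone_measureReal_le : Monotone fun t => P.real {ω | τ ω ≤ t} :=
  fun _ _ hst => measureReal_mono fun _ hω => le_trans hω hst

/-- The distribution function of a `[0, ∞]`-valued random variable. -/
noncomputable def DistFun.ofRandomVariable (P : Measure Ω) [IsProbabilityMeasure P] (τ : Ω → EReal)
    (hτ : ∀ t, MeasurableSet {ω | τ ω ≤ t}) (h0 : ∀ ω, 0 ≤ τ ω) : DistFun where
  toFun t := P.real {ω | τ ω ≤ t}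
  mem_Icc' _ := ⟨measureReal_nonneg, measureReal_le_one⟩
  cadlag' := ⟨fun t => tendsto_measureReal_le_nhdsGT hτ t,
    fun t => ⟨_, tendsto_measureReal_le_nhdsLT hτ t⟩⟩
  mono' := monotone_measureReal_le
  leftLim_zero' := by
    simpa [not_lt.2 (h0 _)] using tendsto_measureReal_le_nhdsLT (P := P) hτ 0
  top' := by simp

/-- The left limit at `t` is `P(τ < t)`, so continuity there excludes an atom. -/
lemma ae_ne_of_continuousAt_measureReal_le (hτ : ∀ t, MeasurableSet {ω | τ ω ≤ t}) {t : EReal}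
    (ht : ⊥ < t) (hc : ContinuousAt (fun s => P.real {ω | τ ω ≤ s}) t) : ∀ᵐ ω ∂P, τ ω ≠ t := by
  have : (𝓝[<] t).NeBot := nhdsLT_neBot_of_exists_lt ⟨⊥, ht⟩
  have heq : P.real {ω | τ ω < t} = P.real {ω | τ ω ≤ t} :=
    tendsto_nhds_unique (tendsto_measureReal_le_nhdsLT hτ t)
      (hc.tendsto.mono_left nhdsWithin_le_nhds)
  have hae : ({ω | τ ω < t} : Set Ω) =ᵐ[P] {ω | τ ω ≤ t} :=
    ae_eq_of_subset_of_measure_ge (fun ω (hω : τ ω < t) => hω.le)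
      ((measureReal_eq_measureReal_iff).1 heq).ge
      (measurableSet_lt (measurable_of_Iic hτ) measurable_const).nullMeasurableSet
      (measure_ne_top _ _)
  filter_upwards [hae.mem_iff] with ω hω heq
  exact (show τ ω < t from hω.2 (show τ ω ≤ t from heq.le)).ne heq

end DistributionFunction

/-! ### The crossing property at the hitting time, and continuity of `Γ`. -/

/-- Almost surely, the driving path goes strictly below its value at the hitting time immediately
after the hitting time. -/
lemma ae_exists_lt_hitTime {Ω : Type*} [MeasurableSpace Ω] {P : Measure Ω}
    {X₀ : Ω → ℝ} {Z : ℝ≥0 → Ω → ℝ} (hY : ∀ t, StronglyMeasurable fun ω => X₀ ω + Z t ω)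
    (hZ : ∀ ω, Continuous fun t => Z t ω) {α : ℝ} (hα : 0 < α)
    (h_cross : CrossingProperty P X₀ Z hY) (ℓ : DistFun) :
    ∀ᵐ ω ∂P, ∀ T : ℝ≥0, hitTime X₀ Z α ℓ ω = ((T : ℝ) : EReal) →
      ∀ h : ℝ≥0, 0 < h → ∃ s ≤ h, Z (T + s) ω < Z T ω := by
  classical
  let τ : Ω → WithTop ℝ≥0 := fun ω =>
    if hitTime X₀ Z α ℓ ω < ⊤ then ((hitTime X₀ Z α ℓ ω).toReal.toNNReal : WithTop ℝ≥0) else ⊤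
  have hτ_coe : ∀ ω (T : ℝ≥0), hitTime X₀ Z α ℓ ω = ((T : ℝ) : EReal) → τ ω = T := by
    intro ω T hT
    simp only [τ, hT, EReal.coe_lt_top, if_true, EReal.toReal_coe, Real.toNNReal_coe]
  have hτ : IsStoppingTime (Filtration.natural (fun t ω => X₀ ω + Z t ω) hY) τ := by
    intro t
    have hset : {ω | τ ω ≤ t} = {ω | hitTime X₀ Z α ℓ ω ≤ ((t : ℝ) : EReal)} := by
      ext ω
      simp only [mem_ofPred_eq]
      by_cases hω : hitTime X₀ Z α ℓ ω < ⊤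
      · obtain ⟨T, hT, -⟩ := exists_hitTime_eq (hZ ω) hα hω
        rw [hτ_coe ω T hT, hT, WithTop.coe_le_coe, EReal.coe_le_coe_iff, NNReal.coe_le_coe]
      · have hτω : τ ω = ⊤ := if_neg hω
        rw [hτω, not_lt_top_iff.1 hω]
        exact iff_of_false (WithTop.coe_lt_top t).not_ge (EReal.coe_lt_top _).not_ge
    rw [hset]
    exact measurableSet_hitTime_le_coe hZ hα ℓ fun s hs =>
      ((Filtration.stronglyAdapted_natural hY s).mono
        ((Filtration.natural _ hY).mono hs)).measurable
  -- The countably many windows `1 / (k + 1)` give one null set valid for all `h`.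
  have hnull : ∀ᵐ ω ∂P, ∀ k : ℕ, ¬ ∃ T : ℝ≥0, τ ω = T ∧
      (⨅ s : Icc (0 : ℝ≥0) (1 / ((k : ℝ≥0) + 1)), (Z (T + s) ω - Z T ω)) = 0 :=
    ae_all_iff.2 fun k => by
      simpa [ae_iff] using h_cross τ hτ (1 / ((k : ℝ≥0) + 1)) (by positivity)
  filter_upwards [hnull] with ω hω T hT h hh
  by_contra! hge
  obtain ⟨k, hk⟩ := exists_nat_one_div_lt hh
  -- Without a dip the increments are nonnegative and vanish at `s = 0`, so their infimum is `0`.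
  refine hω k ⟨T, hτ_coe ω T hT, le_antisymm ?_ ?_⟩
  · refine (ciInf_le (f := fun s : Icc (0 : ℝ≥0) (1 / ((k : ℝ≥0) + 1)) => Z (T + s) ω - Z T ω)
      ⟨0, ?_⟩ ⟨0, by simp⟩).trans_eq (by simp)
    rintro _ ⟨s, rfl⟩
    exact sub_nonneg.2 (hge s (s.2.2.trans hk.le))
  · have : Nonempty (Icc (0 : ℝ≥0) (1 / ((k : ℝ≥0) + 1))) := ⟨⟨0, by simp⟩⟩
    exact le_ciInf fun s => sub_nonneg.2 (hge s (s.2.2.trans hk.le))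

theorem proposition2p1 {Ω : Type*} [MeasurableSpace Ω] (P : Measure Ω) [IsProbabilityMeasure P]
    (X₀ : Ω → ℝ) (hX₀ : Measurable X₀)
    (Z : ℝ≥0 → Ω → ℝ) (hZ : ∀ t, Measurable (Z t))
    (hZ_cont : ∀ ω, Continuous fun t => Z t ω) (hZ_zero : ∀ ω, Z 0 ω = 0)
    (h_indep : IndepFun X₀ (fun ω t => Z t ω) P)
    (α : ℝ) (hα : 0 < α)
    (h_cross : CrossingProperty P X₀ Z fun t => (hX₀.add (hZ t)).stronglyMeasurable) :
    ∃ Γ : DistFun → DistFun,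
      (∀ (ℓ : DistFun) (t : EReal), Γ ℓ t = P.real {ω | hitTime X₀ Z α ℓ ω ≤ t}) ∧
      Continuous Γ := by
  have hmeas := measurableSet_hitTime_le hX₀ hZ hZ_cont hα
  refine ⟨fun ℓ => DistFun.ofRandomVariable P (hitTime X₀ Z α ℓ) (hmeas ℓ)
    fun ω => hitTime_nonneg ℓ, fun _ _ => rfl, ?_⟩
  refine continuous_iff_continuousAt.2 fun ℓ => DistFun.tendsto_iff.2 fun t ht0 htc => ?_
  refine tendsto_measureReal_of_ae_eventually (hmeas ℓ t) (fun m => hmeas m t) ?_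
  rcases eq_or_ne t ⊤ with rfl | htop
  · simp
  filter_upwards [ae_ne_of_continuousAt_measureReal_le (hmeas ℓ)
    ((EReal.bot_lt_zero).trans_le ht0) htc,
    ae_exists_lt_hitTime _ hZ_cont hα h_cross ℓ] with ω hne hcross
  rcases lt_or_gt_of_ne hne with h | h
  · filter_upwards [eventually_hitTime_lt (hZ_cont ω) hα hcross h] with m hm
    exact iff_of_true hm.le h.le
  · filter_upwards [eventually_lt_hitTime (hZ_cont ω) hα htop h] with m hm
    exact iff_of_false (not_le.2 hm) (not_le.2 h)
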